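/- Consider a leader's decision $\hat x\in\mathbb R^d$ and scenarios $\xi^1,\dots,\xi^N\in\mathbb R^k$. Let $A\in\mathbb R^{m\times n}$, and let $c(\xi)=C\xi+c_0\in\mathbb R^n$, $v(\xi)=V\xi+v_0\in\mathbb R^n$, $b_x(\xi)=\big(\sum_{i=1}^d x_iB_i+B_0\big)\xi+\sum_{i=1}^d x_ib_i+b_0\in\mathbb R^m$ be affine in $\xi$. Assume that for every $s$ the set $\{y\in\mathbb R^n: Ay\le b_{\hat x}(\xi^s)\}$ is nonempty and bounded. Let $\Omega(\hat x,\xi^s)=\arg\min_y\{c(\xi^s)^\top y: Ay\le b_{\hat x}(\xi^s)\}$ be the set of the follower's optimal responses and $\Psi(\hat x,\xi^s)=\max_{y\in\Omega(\hat x,\xi^s)}v(\xi^s)^\top y$ the pessimistic cost. Let $\mu_0\in\mathbb R^k$, let $\Sigma_0\in\mathbb R^{k\times k}$ be symmetric positive definite, let $\gamma_1\ge 0$, $\gamma_2\ge 1$, and let $\mathcal D_{\rm dis}$ be the set of all $p\in\mathbb R^N_+$ with $$\sum_{s}p_s=1,\qquad \Big(\sum_s p_s\xi^s-\mu_0\Big)^\top\Sigma_0^{-1}\Big(\sum_s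 p_s\xi^s-\mu_0\Big)\le\gamma_1,\qquad \sum_s p_s(\xi^s-\mu_0)(\xi^s-\mu_0)^\top\preceq\gamma_2\Sigma_0 .$$ Consider the second-stage SDP $$\begin{aligned}\min_{Q,q,r,t,\lambda,p^s,y^s}\ & r+t\\ \text{s.t. }\ & r\ge b_{\hat x}(\xi^s)^\top p^s+c(\xi^s)^\top y^s-(\xi^s)^\top Q\xi^s-(\xi^s)^\top q,\quad s=1,\dots,N, &(\ast)\\ & A^\top p^s+\lambda c(\xi^s)=v(\xi^s),\quad Ay^s\le\lambda b_{\hat x}(\xi^s),\quad p^s\ge0,\quad s=1,\dots,N,\\ & t\ge(\gamma_2\Sigma_0+\mu_0\mu_0^\top)\cdot Q+\mu_0^\top q+\sqrt{\gamma_1}\,\big\|\Sigma_0^{1/2}(q+2Q\mu_0)\big\|,\\ & Q\succeq0,\quad \lambda\ge0,\end{aligned}$$ and its (conic) Lagrangian dual. Take any optimal solution of this dual, and let $\gamma^*\in\mathbb R^N$ be its component consisting of the multipliers of the scenario constraints $(\ast)$. Then $\gamma^*\in\mathcal D_{\rm dis}$, and the distribution $\mathbb P(\xi=\xi^s)=\gamma^{s*}$,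 $s=1,\dots,N$, attains the worst-case expected pessimistic cost: $$\sum_{s=1}^N\gamma^{s*}\,\Psi(\hat x,\xi^s)=\max_{p\in\mathcal D_{\rm dis}}\ \sum_{s=1}^N p_s\,\Psi(\hat x,\xi^s),$$ where the maximum defining each $\Psi(\hat x,\xi^s)$ is attained. -/

import Mathlib

open scoped Matrix

noncomputable section

namespace PessimisticBilevel

/-- Data of a pessimistic bilevel program with affine uncertainty, together with finitely many
scenarios `ξ s` of the uncertainty and the parameters of the moment ambiguity set.
Dimensions: `d` leader variables, `k` uncertain parameters, `n` follower variables, `m` follower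
constraints, `N` scenarios. -/
structure Instance (d k n m N : ℕ) where
  /-- follower constraint matrix -/
  A : Matrix (Fin m) (Fin n) ℝ
  /-- follower cost `c(ξ) = C ξ + c₀` -/
  C : Matrix (Fin n) (Fin k) ℝ
  c₀ : Fin n → ℝ
  /-- leader's indirect cost `v(ξ) = V ξ + v₀` -/
  V : Matrix (Fin n) (Fin k) ℝ
  v₀ : Fin n → ℝ
  /-- `B_x = ∑ i, x i • B i + B₀` -/
  B : Fin d → Matrix (Fin m) (Fin k) ℝ
  B₀ : Matrix (Fin m) (Fin k) ℝ
  /-- `b_{x0} = ∑ i, x i • b i + b₀` -/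
  b : Fin d → Fin m → ℝ
  b₀ : Fin m → ℝ
  /-- the scenarios -/
  ξ : Fin N → Fin k → ℝ
  /-- moment estimates `μ₀`, `Σ₀` (written `Sig₀`) and radii `γ₁`, `γ₂` of the ambiguity set -/
  μ₀ : Fin k → ℝ
  Sig₀ : Matrix (Fin k) (Fin k) ℝ
  γ₁ : ℝ
  γ₂ : ℝ

/-- The Euclidean norm of a real vector. -/
def l2norm {k : ℕ} (u : Fin k → ℝ) : ℝ := ‖WithLp.toLp 2 u‖

/-- Primal variables `(Q, q, r, t, λ, p, y)` of the second-stage SDP (`lam` is `λ`). -/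
structure PrimalVars (k n m N : ℕ) where
  Q : Matrix (Fin k) (Fin k) ℝ
  q : Fin k → ℝ
  r : ℝ
  t : ℝ
  lam : ℝ
  p : Fin N → Fin m → ℝ
  y : Fin N → Fin n → ℝ

/-- Lagrange multipliers of the second-stage SDP: `γ s` for the scenario constraints, `χ s` for the
equations, `σ s` for the inequalities `A y s ≤ λ b_x(ξ s)`, and `(τ, μ)` for the
second-order cone constraint. -/
structure Multipliers (k n m N : ℕ) where
  γ : Fin N → ℝ
  χ : Fin N → Fin n → ℝ
  σ : Fin N → Fin m → ℝ
  τ : ℝ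
  μ : Fin k → ℝ

namespace Instance

variable {d k n m N : ℕ} (D : Instance d k n m N)

/-- `c(ξ s)` -/
def c (s : Fin N) : Fin n → ℝ := D.C *ᵥ D.ξ s + D.c₀

/-- `v(ξ s)` -/
def v (s : Fin N) : Fin n → ℝ := D.V *ᵥ D.ξ s + D.v₀

/-- `b_x(ξ s) = B_x ξ s + b_{x0}` -/
def rhs (x : Fin d → ℝ) (s : Fin N) : Fin m → ℝ :=
  (∑ i, x i • D.B i + D.B₀) *ᵥ D.ξ s + (∑ i, x i • D.b i + D.b₀)

/-! ### The bilevel problem and the ambiguity set -/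

/-- The follower's feasible set `{y | A y ≤ b_x(ξ s)}`. -/
def followerFeasible (x : Fin d → ℝ) (s : Fin N) : Set (Fin n → ℝ) :=
  {y | D.A *ᵥ y ≤ D.rhs x s}

/-- `Ω(x, ξ s)`: the set of optimal solutions of the follower. -/
def followerOptimal (x : Fin d → ℝ) (s : Fin N) : Set (Fin n → ℝ) :=
  {y | y ∈ D.followerFeasible x s ∧ ∀ z ∈ D.followerFeasible x s, D.c s ⬝ᵥ y ≤ D.c s ⬝ᵥ z}

/-- The leader's possible costs `v(ξ s)ᵀ y`, where `y` ranges over `Ω(x, ξ s)`. -/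
def leaderCosts (x : Fin d → ℝ) (s : Fin N) : Set ℝ :=
  (fun y => D.v s ⬝ᵥ y) '' D.followerOptimal x s

/-- The pessimistic cost `Ψ(x, ξ s) = max {v(ξ s)ᵀ y | y ∈ Ω(x, ξ s)}`. -/
def pessimisticCost (x : Fin d → ℝ) (s : Fin N) : ℝ := sSup (D.leaderCosts x s)

/-- The expectation of `Ψ(x, ξ)` when scenario `ξ s` has probability `p s`. -/
def expectedCost (x : Fin d → ℝ) (p : Fin N → ℝ) : ℝ := ∑ s, p s * D.pessimisticCost x s

/-- Relatively complete recourse at `x`: in every scenario the follower's feasible set is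
nonempty and bounded. -/
def HasRecourse (x : Fin d → ℝ) : Prop :=
  ∀ s, (D.followerFeasible x s).Nonempty ∧ Bornology.IsBounded (D.followerFeasible x s)

/-- The ambiguity set of distributions on the scenarios. -/
def ambiguitySet : Set (Fin N → ℝ) :=
  {p | 0 ≤ p ∧ ∑ s, p s = 1 ∧
    (∑ s, p s • D.ξ s - D.μ₀) ⬝ᵥ (D.Sig₀⁻¹ *ᵥ (∑ s, p s • D.ξ s - D.μ₀)) ≤ D.γ₁ ∧
    (D.γ₂ • D.Sig₀ -
      ∑ s, p s • Matrix.vecMulVec (D.ξ s - D.μ₀) (D.ξ s - D.μ₀)).PosSemidef}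

/-! ### The second-stage SDP -/

open scoped MatrixOrder Matrix.Norms.L2Operator in
/-- The positive semidefinite square root of `Σ₀`. -/
def sqrtSig₀ : Matrix (Fin k) (Fin k) ℝ := CFC.sqrt D.Sig₀

/-- Objective `r + t`, to be minimized. -/
def objective (z : PrimalVars k n m N) : ℝ := z.r + z.t

/-- The sign constraints `Q ⪰ 0`, `λ ≥ 0`, `p s ≥ 0`. -/
def signConstraints (k n m N : ℕ) : Set (PrimalVars k n m N) :=
  {z | z.Q.PosSemidef ∧ 0 ≤ z.lam ∧ ∀ s, 0 ≤ z.p s}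

/-- Left side of the scenario constraint
`b_x(ξ s)ᵀ p s + c(ξ s)ᵀ y s - (ξ s)ᵀ Q ξ s - (ξ s)ᵀ q - r ≤ 0`. -/
def scenarioGap (x : Fin d → ℝ) (z : PrimalVars k n m N) (s : Fin N) : ℝ :=
  D.rhs x s ⬝ᵥ z.p s + D.c s ⬝ᵥ z.y s - D.ξ s ⬝ᵥ (z.Q *ᵥ D.ξ s) - D.ξ s ⬝ᵥ z.q - z.r

/-- Left side of the equation `v(ξ s) - Aᵀ p s - λ c(ξ s) = 0`. -/
def equationGap (z : PrimalVars k n m N) (s : Fin N) : Fin n → ℝ :=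
  D.v s - D.Aᵀ *ᵥ z.p s - z.lam • D.c s

/-- Left side of the inequality `A y s - λ b_x(ξ s) ≤ 0`. -/
def followerGap (x : Fin d → ℝ) (z : PrimalVars k n m N) (s : Fin N) : Fin m → ℝ :=
  D.A *ᵥ z.y s - z.lam • D.rhs x s

/-- `t - (γ₂ Σ₀ + μ₀ μ₀ᵀ) • Q - μ₀ᵀ q`, the scalar part of the second-order cone constraint. -/
def coneScalar (z : PrimalVars k n m N) : ℝ :=
  z.t - ((D.γ₂ • D.Sig₀ + Matrix.vecMulVec D.μ₀ D.μ₀)ᵀ * z.Q).trace - D.μ₀ ⬝ᵥ z.q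

/-- `√γ₁ Σ₀^{1/2} (q + 2 Q μ₀)`, the vector part of the second-order cone constraint. -/
def coneVector (z : PrimalVars k n m N) : Fin k → ℝ :=
  √D.γ₁ • (D.sqrtSig₀ *ᵥ (z.q + (2 : ℝ) • (z.Q *ᵥ D.μ₀)))

/-- Feasibility in the second-stage SDP for the leader's decision `x`; the last constraint reads
`t ≥ (γ₂ Σ₀ + μ₀ μ₀ᵀ) • Q + μ₀ᵀ q + √γ₁ ‖Σ₀^{1/2} (q + 2 Q μ₀)‖`. -/
def PrimalFeasible (x : Fin d → ℝ) (z : PrimalVars k n m N) : Prop :=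
  z ∈ signConstraints k n m N ∧
    (∀ s, D.scenarioGap x z s ≤ 0) ∧ (∀ s, D.equationGap z s = 0) ∧
    (∀ s, D.followerGap x z s ≤ 0) ∧ l2norm (D.coneVector z) ≤ D.coneScalar z

/-! ### Its Lagrangian dual -/

/-- The Lagrangian of the second-stage SDP. -/
def lagrangian (x : Fin d → ℝ) (z : PrimalVars k n m N) (w : Multipliers k n m N) : ℝ :=
  objective z + ∑ s, w.γ s * D.scenarioGap x z s + ∑ s, w.χ s ⬝ᵥ D.equationGap z s +
    ∑ s, w.σ s ⬝ᵥ D.followerGap x z s - w.τ * D.coneScalar z + w.μ ⬝ᵥ D.coneVector z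

/-- The dual cone: `γ ≥ 0`, `σ ≥ 0`, `‖μ‖ ≤ τ`, with `χ` free. -/
def dualCone (k n m N : ℕ) : Set (Multipliers k n m N) :=
  {w | 0 ≤ w.γ ∧ (∀ s, 0 ≤ w.σ s) ∧ l2norm w.μ ≤ w.τ}

/-- The dual objective: the infimum of the Lagrangian over the primal variables that satisfy the
sign constraints. -/
def dualObjective (x : Fin d → ℝ) (w : Multipliers k n m N) : EReal :=
  ⨅ z ∈ signConstraints k n m N, (D.lagrangian x z w : EReal)

/-- Feasibility in the dual: the multiplier lies in the dual cone and the Lagrangian is bounded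
below. -/
def DualFeasible (x : Fin d → ℝ) (w : Multipliers k n m N) : Prop :=
  w ∈ dualCone k n m N ∧ D.dualObjective x w ≠ ⊥

/-- `w` is an optimal solution of the dual of the second-stage SDP. -/
def DualOptimal (x : Fin d → ℝ) (w : Multipliers k n m N) : Prop :=
  D.DualFeasible x w ∧ ∀ w', D.DualFeasible x w' → D.dualObjective x w' ≤ D.dualObjective x w

end Instance

end PessimisticBilevel

end

/-!
The Lagrangian is affine in the primal variables (`lagrangian_eq`), so it is bounded below on the
cone of sign constraints exactly when its linear part is nonnegative there. This makes the dual
explicit (`DualConstraints`): maximize `∑ s, χ s ⬝ᵥ v s` over multipliers for which `γ` is a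
probability vector with mean `μ₀ + √γ₁ Σ₀^{1/2} μ`, where `‖μ‖ ≤ 1`, and with second moments about
`μ₀` bounded by `γ₂ Σ₀`, while each `(χ s, σ s)` satisfies the optimality system of the follower's
linear program scaled by `γ s`. The requirement on `γ` is membership in the ambiguity set
(`DualConstraints.mem_ambiguitySet`).

The variable `λ` is shared by all scenarios, so the dual only requires the *sum* of the scaled
duality gaps to be nonpositive. Weak duality (`dualityGap_nonneg`) makes each gap nonnegative, hence
zero, and `χ s` is `γ s` times an optimal response of the follower; where `γ s = 0`, boundedness of
the feasible set forces `χ s = 0`. So the dual objective is at most the expected pessimistic cost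
under `γ` (`DualConstraints.dotProduct_v_le`).

Conversely, each `p` in the ambiguity set extends to a dual feasible multiplier with value the
expected pessimistic cost under `p` (`exists_dualFeasible_of_mem_ambiguitySet`): take
`χ s = p s • y s` with `y s` a worst optimal response, and `σ s = p s • a s` with `a s` a dual solution of the
follower's program, which exists by linear programming duality (`exists_dual_certificate`). At an
optimal multiplier, the two comparisons give the claim.
-/

/-! ### Farkas' lemma and linear programming duality -/

/-- **Farkas' lemma**: a linear functional that is nonpositive wherever finitely many functionals
are nonpositive is a nonnegative combination of them. -/
theorem exists_nonneg_combination_of_nonpos {V ι : Type*} [AddCommGroup V] [Module ℝ V]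
    (S : Finset ι) (f : ι → V →ₗ[ℝ] ℝ) (g : V →ₗ[ℝ] ℝ)
    (h : ∀ v, (∀ i ∈ S, f i v ≤ 0) → g v ≤ 0) :
    ∃ a : ι → ℝ, (∀ i, 0 ≤ a i) ∧ g = ∑ i ∈ S, a i • f i := by
  classical
  induction S using Finset.induction_on generalizing f g with
  | empty =>
    refine ⟨0, fun _ => le_rfl, LinearMap.ext fun v => ?_⟩
    have h₁ := h v (by simp)
    have h₂ := h (-v) (by simp)
    simp only [map_neg] at h₂
    simp only [Finset.sum_empty, LinearMap.zero_apply]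
    linarith
  | insert j S hj ih =>
    by_cases hS : ∀ v, (∀ i ∈ S, f i v ≤ 0) → g v ≤ 0
    · obtain ⟨a, ha, rfl⟩ := ih f g hS
      refine ⟨Function.update a j 0, fun i => ?_, ?_⟩
      · by_cases hi : i = j
        · simp [hi]
        · simpa [hi] using ha i
      · rw [Finset.sum_insert hj]
        simp only [Function.update_self, zero_smul, zero_add]
        refine Finset.sum_congr rfl fun i hi => ?_
        rw [Function.update_of_ne (ne_of_mem_of_not_mem hi hj)]
    · push Not at hS
      obtain ⟨v₀, hv₀, hg₀⟩ := hS
      have hj₀ : 0 < f j v₀ := by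
        by_contra hneg
        exact absurd (h v₀ (by simpa using ⟨not_lt.mp hneg, hv₀⟩)) (not_le.mpr hg₀)
      -- Subtracting multiples of `f j` makes all functionals vanish at `v₀`, so that `v` may be
      -- moved along `v₀` into the kernel of `f j`.
      obtain ⟨a, ha, hga⟩ := ih (fun i => f i - (f i v₀ / f j v₀) • f j)
        (g - (g v₀ / f j v₀) • f j) (fun v hv => by
          have key := h (v - (f j v / f j v₀) • v₀) (fun i hi => by
            rcases Finset.mem_insert.mp hi with rfl | hi
            · simp [hj₀.ne']
            · have := hv i hi
              simp only [LinearMap.sub_apply, LinearMap.smul_apply, smul_eq_mul, map_sub,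
                map_smul] at this ⊢
              convert this using 2
              ring)
          simp only [LinearMap.sub_apply, LinearMap.smul_apply, smul_eq_mul, map_sub,
            map_smul] at key ⊢
          convert key using 2
          ring)
      set e := g v₀ / f j v₀ - ∑ i ∈ S, a i * (f i v₀ / f j v₀) with he
      have he₀ : 0 ≤ e := by
        have : ∑ i ∈ S, a i * (f i v₀ / f j v₀) ≤ 0 := Finset.sum_nonpos fun i hi =>
          mul_nonpos_of_nonneg_of_nonpos (ha i) (div_nonpos_of_nonpos_of_nonneg (hv₀ i hi) hj₀.le)
        have := div_pos hg₀ hj₀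
        linarith
      refine ⟨Function.update a j e, fun i => ?_, ?_⟩
      · by_cases hi : i = j
        · simpa [hi] using he₀
        · simpa [hi] using ha i
      · rw [Finset.sum_insert hj, Function.update_self]
        have hsum : ∑ i ∈ S, Function.update a j e i • f i = ∑ i ∈ S, a i • f i :=
          Finset.sum_congr rfl fun i hi => by
            rw [Function.update_of_ne (ne_of_mem_of_not_mem hi hj)]
        rw [hsum]
        ext v
        have := LinearMap.congr_fun hga v
        simp only [LinearMap.sub_apply, LinearMap.smul_apply, smul_eq_mul, LinearMap.add_apply,
          LinearMap.sum_apply, mul_sub, Finset.sum_sub_distrib] at this ⊢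
        rw [he, sub_mul, Finset.sum_mul]
        simp only [← mul_assoc] at this ⊢
        linarith

/-- Strong duality for the linear program `min {c ⬝ᵥ y | M *ᵥ y ≤ b}`: an optimal solution has a
dual certificate. -/
theorem exists_dual_certificate {m n : ℕ} (M : Matrix (Fin m) (Fin n) ℝ) (b : Fin m → ℝ)
    (c y : Fin n → ℝ) (hy : M *ᵥ y ≤ b) (hopt : ∀ z, M *ᵥ z ≤ b → c ⬝ᵥ y ≤ c ⬝ᵥ z) :
    ∃ a : Fin m → ℝ, 0 ≤ a ∧ c + Mᵀ *ᵥ a = 0 ∧ y ⬝ᵥ c + a ⬝ᵥ b ≤ 0 := by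
  -- Farkas' lemma is applied to the homogenized system `M d ≤ t b`, `0 ≤ t` in `(d, t)`.
  let F : Option (Fin m) → ((Fin n → ℝ) × ℝ) →ₗ[ℝ] ℝ := fun o => o.elim
    (-LinearMap.snd ℝ (Fin n → ℝ) ℝ)
    (fun i => (LinearMap.proj i ∘ₗ Matrix.mulVecLin M) ∘ₗ LinearMap.fst ℝ _ ℝ -
      b i • LinearMap.snd ℝ (Fin n → ℝ) ℝ)
  let G : ((Fin n → ℝ) × ℝ) →ₗ[ℝ] ℝ :=
    (c ⬝ᵥ y) • LinearMap.snd ℝ (Fin n → ℝ) ℝ - (dotProductBilin ℝ ℝ c) ∘ₗ LinearMap.fst ℝ _ ℝ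
  have hFn : ∀ d t, F none (d, t) = -t := fun d t => rfl
  have hFs : ∀ i d t, F (some i) (d, t) = (M *ᵥ d) i - b i * t := fun i d t => rfl
  have hG : ∀ d t, G (d, t) = (c ⬝ᵥ y) * t - c ⬝ᵥ d := fun d t => rfl
  obtain ⟨a, ha, hGa⟩ := exists_nonneg_combination_of_nonpos Finset.univ F G (by
    rintro ⟨d, t⟩ hv
    have ht : 0 ≤ t := by simpa [hFn] using hv none (Finset.mem_univ _)
    have hd : ∀ i, (M *ᵥ d) i ≤ b i * t := fun i => by
      simpa [hFs] using hv (some i) (Finset.mem_univ _)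
    rw [hG]
    rcases ht.eq_or_lt with rfl | ht
    · have := hopt (y + d) (fun i => by
        have h₁ := hd i
        have h₂ := hy i
        rw [Matrix.mulVec_add, Pi.add_apply]
        linarith)
      rw [dotProduct_add] at this
      linarith
    · have := hopt (t⁻¹ • d) (fun i => by
        rw [Matrix.mulVec_smul, Pi.smul_apply, smul_eq_mul, inv_mul_le_iff₀ ht]
        linarith [hd i])
      rw [dotProduct_smul, smul_eq_mul, le_inv_mul_iff₀ ht] at this
      linarith)
  have hval : ∀ d t, (c ⬝ᵥ y) * t - c ⬝ᵥ d =
      a none * -t + ∑ i, a (some i) * ((M *ᵥ d) i - b i * t) := fun d t => by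
    have := LinearMap.congr_fun hGa (d, t)
    rw [hG] at this
    simpa [LinearMap.sum_apply, Fintype.sum_option, hFn, hFs] using this
  refine ⟨fun i => a (some i), fun i => ha _, ?_, ?_⟩
  · refine dotProduct_eq_zero _ fun d => ?_
    have := hval d 0
    have h' : ∑ i, a (some i) * (M *ᵥ d) i = (fun i => a (some i)) ⬝ᵥ (M *ᵥ d) := rfl
    simp only [mul_zero, sub_zero, neg_zero, zero_add] at this
    rw [h', Matrix.dotProduct_mulVec, ← Matrix.mulVec_transpose] at this
    rw [add_dotProduct]
    linarith
  · have := hval 0 1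
    have h' : ∑ i, a (some i) * b i = (fun i => a (some i)) ⬝ᵥ b := rfl
    simp only [dotProduct_zero, Matrix.mulVec_zero, Pi.zero_apply, mul_one, zero_sub, sub_zero,
      mul_neg, Finset.sum_neg_distrib] at this
    rw [h'] at this
    rw [dotProduct_comm y c]
    linarith [ha none]

/-! ### Semidefinite matrices -/

open scoped MatrixOrder Matrix.Norms.L2Operator in
theorem trace_mul_nonneg_of_posSemidef {k : ℕ} {M Q : Matrix (Fin k) (Fin k) ℝ}
    (hM : M.PosSemidef) (hQ : Q.PosSemidef) : 0 ≤ (M * Q).trace := by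
  obtain ⟨R, rfl⟩ := CStarAlgebra.nonneg_iff_eq_star_mul_self.mp hQ.nonneg
  rw [Matrix.star_eq_conjTranspose, ← Matrix.mul_assoc, Matrix.trace_mul_comm, ← Matrix.mul_assoc]
  exact (hM.mul_mul_conjTranspose_same R).trace_nonneg

namespace PessimisticBilevel.Instance

variable {d k n m N : ℕ} (D : Instance d k n m N)

open scoped MatrixOrder Matrix.Norms.L2Operator in
theorem sqrtSig₀_mul_self (hS : D.Sig₀.PosDef) : D.sqrtSig₀ * D.sqrtSig₀ = D.Sig₀ :=
  CFC.sqrt_mul_sqrt_self _ hS.posSemidef.nonneg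

open scoped MatrixOrder Matrix.Norms.L2Operator in
theorem sqrtSig₀_transpose : D.sqrtSig₀ᵀ = D.sqrtSig₀ := by
  have h : IsSelfAdjoint D.sqrtSig₀ := (CFC.sqrt_nonneg D.Sig₀).isSelfAdjoint
  rw [← Matrix.conjTranspose_eq_transpose_of_trivial]
  exact h

theorem isUnit_det_sqrtSig₀ (hS : D.Sig₀.PosDef) : IsUnit D.sqrtSig₀.det := by
  have h : D.sqrtSig₀.det * D.sqrtSig₀.det = D.Sig₀.det := by
    rw [← Matrix.det_mul, D.sqrtSig₀_mul_self hS]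
  refine isUnit_iff_ne_zero.mpr fun h₀ => hS.det_pos.ne' ?_
  rw [← h, h₀, mul_zero]

/-- In the coordinates `u = Σ₀^{1/2} e`, the quadratic form of `Σ₀⁻¹` is the squared Euclidean norm. -/
theorem sqrtSig₀_mulVec_dotProduct_inv (hS : D.Sig₀.PosDef) (e : Fin k → ℝ) :
    (D.sqrtSig₀ *ᵥ e) ⬝ᵥ (D.Sig₀⁻¹ *ᵥ (D.sqrtSig₀ *ᵥ e)) = e ⬝ᵥ e := by
  have hu := D.isUnit_det_sqrtSig₀ hS
  rw [← D.sqrtSig₀_mul_self hS, Matrix.mul_inv_rev, Matrix.mulVec_mulVec, Matrix.mul_assoc,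
    Matrix.nonsing_inv_mul _ hu, Matrix.mul_one, Matrix.dotProduct_mulVec,
    ← Matrix.mulVec_transpose, Matrix.transpose_nonsing_inv, D.sqrtSig₀_transpose,
    Matrix.mulVec_mulVec, Matrix.nonsing_inv_mul _ hu, Matrix.one_mulVec]

theorem _root_.PessimisticBilevel.l2norm_sq {k : ℕ} (u : Fin k → ℝ) : l2norm u ^ 2 = u ⬝ᵥ u := by
  rw [l2norm, EuclideanSpace.real_norm_sq_eq]
  simp [dotProduct, sq]

/-! ### The follower's problem -/

theorem isCompact_followerFeasible {x : Fin d → ℝ} (hrec : D.HasRecourse x) (s : Fin N) :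
    IsCompact (D.followerFeasible x s) :=
  Metric.isCompact_of_isClosed_isBounded
    (isClosed_le (continuous_const.matrix_mulVec continuous_id) continuous_const) (hrec s).2

theorem isCompact_followerOptimal {x : Fin d → ℝ} (hrec : D.HasRecourse x) (s : Fin N) :
    IsCompact (D.followerOptimal x s) := by
  have hset : D.followerOptimal x s = D.followerFeasible x s ∩
      ⋂ z ∈ D.followerFeasible x s, {y | D.c s ⬝ᵥ y ≤ D.c s ⬝ᵥ z} := by
    ext y
    simp [followerOptimal]
  rw [hset]
  exact (D.isCompact_followerFeasible hrec s).inter_right <| isClosed_biInter fun z _ =>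
    isClosed_le (continuous_const.dotProduct continuous_id) continuous_const

theorem followerOptimal_nonempty {x : Fin d → ℝ} (hrec : D.HasRecourse x) (s : Fin N) :
    (D.followerOptimal x s).Nonempty := by
  obtain ⟨y, hy, hmin⟩ := (D.isCompact_followerFeasible hrec s).exists_isMinOn (hrec s).1
    (f := fun y => D.c s ⬝ᵥ y) (continuous_const.dotProduct continuous_id).continuousOn
  exact ⟨y, hy, fun z hz => hmin hz⟩

theorem isGreatest_pessimisticCost {x : Fin d → ℝ} (hrec : D.HasRecourse x) (s : Fin N) :
    IsGreatest (D.leaderCosts x s) (D.pessimisticCost x s) :=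
  ((D.isCompact_followerOptimal hrec s).image
    (continuous_const.dotProduct continuous_id)).isGreatest_sSup
      ((D.followerOptimal_nonempty hrec s).image _)

/-- A recession direction of a nonempty bounded polyhedron vanishes. -/
theorem eq_zero_of_mulVec_nonpos {x : Fin d → ℝ} (hrec : D.HasRecourse x) (s : Fin N)
    {e : Fin n → ℝ} (he : D.A *ᵥ e ≤ 0) : e = 0 := by
  obtain ⟨y, hy⟩ := (hrec s).1
  obtain ⟨R, hR⟩ := (hrec s).2.exists_norm_le
  by_contra hne
  have hpos : 0 < ‖e‖ := norm_pos_iff.mpr hne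
  have hR₀ : 0 ≤ R := (norm_nonneg y).trans (hR y hy)
  set a : ℝ := (2 * R + 1) / ‖e‖ with ha
  have ha₀ : 0 ≤ a := by positivity
  have hmem : y + a • e ∈ D.followerFeasible x s := fun i => by
    have h₁ := hy i
    have h₂ := mul_nonpos_of_nonneg_of_nonpos ha₀ (he i)
    simp only [Matrix.mulVec_add, Matrix.mulVec_smul, Pi.add_apply, Pi.smul_apply, smul_eq_mul]
    exact (add_le_add h₁ h₂).trans_eq (add_zero _)
  have h₁ : ‖a • e‖ = 2 * R + 1 := by
    rw [norm_smul, Real.norm_of_nonneg ha₀, ha, div_mul_cancel₀ _ hpos.ne']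
  have h₂ : ‖a • e‖ ≤ ‖y + a • e‖ + ‖y‖ := by
    simpa using norm_sub_le (y + a • e) y
  linarith [hR _ hmem, hR y hy]

/-- Weak duality for the follower's problem scaled by `g ≥ 0`. -/
theorem dualityGap_nonneg {x : Fin d → ℝ} (hrec : D.HasRecourse x) (s : Fin N) {g : ℝ}
    {e : Fin n → ℝ} {a : Fin m → ℝ} (hg : 0 ≤ g) (ha : 0 ≤ a) (he : D.A *ᵥ e ≤ g • D.rhs x s)
    (hc : g • D.c s + D.Aᵀ *ᵥ a = 0) : 0 ≤ e ⬝ᵥ D.c s + a ⬝ᵥ D.rhs x s := by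
  have hA : ∀ z, a ⬝ᵥ (D.A *ᵥ z) = -(g * (z ⬝ᵥ D.c s)) := fun z => by
    rw [Matrix.dotProduct_mulVec, ← Matrix.mulVec_transpose, eq_neg_of_add_eq_zero_right hc,
      neg_dotProduct, smul_dotProduct, smul_eq_mul, dotProduct_comm]
  rcases hg.eq_or_lt with rfl | hg
  · obtain rfl := D.eq_zero_of_mulVec_nonpos hrec s (by simpa using he)
    obtain ⟨y, hy⟩ := (hrec s).1
    have := dotProduct_le_dotProduct_of_nonneg_left hy ha
    rw [hA] at this
    simpa using this
  · have := dotProduct_le_dotProduct_of_nonneg_left he ha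
    rw [hA, dotProduct_smul, smul_eq_mul] at this
    refine nonneg_of_mul_nonneg_right ?_ hg
    linarith

/-- If the scaled duality gap vanishes, `e` is `g` times an optimal response of the follower,
or `0` when `g = 0`. -/
theorem dotProduct_v_le_of_dualityGap_eq_zero {x : Fin d → ℝ} (hrec : D.HasRecourse x)
    (s : Fin N) {g : ℝ} {e : Fin n → ℝ} {a : Fin m → ℝ} (hg : 0 ≤ g) (ha : 0 ≤ a)
    (he : D.A *ᵥ e ≤ g • D.rhs x s) (hc : g • D.c s + D.Aᵀ *ᵥ a = 0)
    (hgap : e ⬝ᵥ D.c s + a ⬝ᵥ D.rhs x s = 0) : e ⬝ᵥ D.v s ≤ g * D.pessimisticCost x s := by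
  rcases hg.eq_or_lt with rfl | hg
  · obtain rfl := D.eq_zero_of_mulVec_nonpos hrec s (by simpa using he)
    simp
  · have hopt : g⁻¹ • e ∈ D.followerOptimal x s := by
      refine ⟨fun i => ?_, fun z hz => ?_⟩
      · rw [Matrix.mulVec_smul, Pi.smul_apply, smul_eq_mul, inv_mul_le_iff₀ hg]
        exact he i
      · have := dotProduct_le_dotProduct_of_nonneg_left hz ha
        rw [Matrix.dotProduct_mulVec, ← Matrix.mulVec_transpose, eq_neg_of_add_eq_zero_right hc,
          neg_dotProduct, smul_dotProduct, smul_eq_mul] at this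
        rw [dotProduct_smul, smul_eq_mul, inv_mul_le_iff₀ hg, dotProduct_comm]
        linarith
    have := (D.isGreatest_pessimisticCost hrec s).2 ⟨_, hopt, rfl⟩
    simp only [dotProduct_smul, smul_eq_mul, inv_mul_le_iff₀ hg] at this
    rwa [dotProduct_comm]

/-! ### The dual in explicit form -/

/-- The vector `√γ₁ Σ₀^{1/2} μ`, through which the multiplier `μ` of the cone constraint enters the
Lagrangian; at dual feasible points it is the deviation of the mean from `μ₀`. -/
noncomputable def meanShift (w : Multipliers k n m N) : Fin k → ℝ := √D.γ₁ • (D.sqrtSig₀ *ᵥ w.μ)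

/-- The coefficient matrix of `Q` in the Lagrangian. -/
noncomputable def coeffQ (w : Multipliers k n m N) : Matrix (Fin k) (Fin k) ℝ :=
  w.τ • (D.γ₂ • D.Sig₀ + Matrix.vecMulVec D.μ₀ D.μ₀) -
    ∑ s, w.γ s • Matrix.vecMulVec (D.ξ s) (D.ξ s) +
    (Matrix.vecMulVec (D.meanShift w) D.μ₀ + Matrix.vecMulVec D.μ₀ (D.meanShift w))

/-- The constraints of the dual in explicit form: the coefficients of the free primal variables
`r`, `t`, `y`, `q` in the Lagrangian vanish, and those of `λ`, `p`, `Q` lie in the duals of the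
cones to which these variables are confined. -/
structure DualConstraints (x : Fin d → ℝ) (w : Multipliers k n m N) : Prop where
  sum_γ : ∑ s, w.γ s = 1
  τ_eq : w.τ = 1
  gap_nonpos : ∑ s, (w.χ s ⬝ᵥ D.c s + w.σ s ⬝ᵥ D.rhs x s) ≤ 0
  mulVec_χ_le : ∀ s, D.A *ᵥ w.χ s ≤ w.γ s • D.rhs x s
  stationary_y : ∀ s, w.γ s • D.c s + D.Aᵀ *ᵥ w.σ s = 0
  mean : D.μ₀ + D.meanShift w = ∑ s, w.γ s • D.ξ s
  posSemidef_coeffQ : (D.coeffQ w).PosSemidef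

theorem trace_vecMulVec_mul {k : ℕ} (a b : Fin k → ℝ) (Q : Matrix (Fin k) (Fin k) ℝ) :
    (Matrix.vecMulVec a b * Q).trace = b ⬝ᵥ (Q *ᵥ a) := by
  rw [Matrix.trace_mul_comm, Matrix.mul_vecMulVec, Matrix.trace_vecMulVec, dotProduct_comm]

/-- The Lagrangian, sorted by the primal variables. -/
theorem lagrangian_eq (hS : D.Sig₀.PosDef) (x : Fin d → ℝ) (z : PrimalVars k n m N)
    (w : Multipliers k n m N) (hQ : z.Qᵀ = z.Q) :
    D.lagrangian x z w = ∑ s, w.χ s ⬝ᵥ D.v s + z.r * (1 - ∑ s, w.γ s) + z.t * (1 - w.τ) -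
      z.lam * ∑ s, (w.χ s ⬝ᵥ D.c s + w.σ s ⬝ᵥ D.rhs x s) +
      ∑ s, z.p s ⬝ᵥ (w.γ s • D.rhs x s - D.A *ᵥ w.χ s) +
      ∑ s, z.y s ⬝ᵥ (w.γ s • D.c s + D.Aᵀ *ᵥ w.σ s) +
      z.q ⬝ᵥ (w.τ • D.μ₀ + D.meanShift w - ∑ s, w.γ s • D.ξ s) +
      (D.coeffQ w * z.Q).trace := by
  have hSt : D.Sig₀ᵀ = D.Sig₀ := by
    rw [← Matrix.conjTranspose_eq_transpose_of_trivial]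
    exact hS.isHermitian
  have hscen : ∑ s, w.γ s * D.scenarioGap x z s = ∑ s, z.p s ⬝ᵥ (w.γ s • D.rhs x s) +
      ∑ s, z.y s ⬝ᵥ (w.γ s • D.c s) - ∑ s, w.γ s * (D.ξ s ⬝ᵥ (z.Q *ᵥ D.ξ s)) -
      z.q ⬝ᵥ ∑ s, w.γ s • D.ξ s - z.r * ∑ s, w.γ s := by
    simp only [dotProduct_sum, Finset.mul_sum, ← Finset.sum_add_distrib, ← Finset.sum_sub_distrib]
    refine Finset.sum_congr rfl fun s _ => ?_
    rw [scenarioGap, dotProduct_smul, dotProduct_smul, dotProduct_smul, dotProduct_comm (z.p s),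
      dotProduct_comm (z.y s), dotProduct_comm z.q]
    simp only [smul_eq_mul]
    ring
  have heq : ∑ s, w.χ s ⬝ᵥ D.equationGap z s = ∑ s, w.χ s ⬝ᵥ D.v s -
      ∑ s, z.p s ⬝ᵥ (D.A *ᵥ w.χ s) - z.lam * ∑ s, w.χ s ⬝ᵥ D.c s := by
    simp only [Finset.mul_sum, ← Finset.sum_sub_distrib]
    refine Finset.sum_congr rfl fun s _ => ?_
    simp only [equationGap, dotProduct_sub, dotProduct_smul, smul_eq_mul]
    rw [Matrix.dotProduct_mulVec (z.p s), ← Matrix.mulVec_transpose, dotProduct_comm (w.χ s)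
      (D.Aᵀ *ᵥ z.p s)]
  have hfol : ∑ s, w.σ s ⬝ᵥ D.followerGap x z s = ∑ s, z.y s ⬝ᵥ (D.Aᵀ *ᵥ w.σ s) -
      z.lam * ∑ s, w.σ s ⬝ᵥ D.rhs x s := by
    simp only [Finset.mul_sum, ← Finset.sum_sub_distrib]
    refine Finset.sum_congr rfl fun s _ => ?_
    simp only [followerGap, dotProduct_sub, dotProduct_smul, smul_eq_mul]
    rw [Matrix.dotProduct_mulVec (w.σ s), ← Matrix.mulVec_transpose, dotProduct_comm]
  have hcone : w.μ ⬝ᵥ D.coneVector z = z.q ⬝ᵥ D.meanShift w +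
      2 * (D.meanShift w ⬝ᵥ (z.Q *ᵥ D.μ₀)) := by
    have : w.μ ⬝ᵥ D.coneVector z =
        D.meanShift w ⬝ᵥ (z.q + (2 : ℝ) • (z.Q *ᵥ D.μ₀)) := by
      rw [coneVector, meanShift, dotProduct_smul, smul_dotProduct, Matrix.dotProduct_mulVec,
        ← Matrix.mulVec_transpose, D.sqrtSig₀_transpose]
    rw [this, dotProduct_add, dotProduct_smul, smul_eq_mul, dotProduct_comm z.q]
  have hsymm : D.μ₀ ⬝ᵥ (z.Q *ᵥ D.meanShift w) = D.meanShift w ⬝ᵥ (z.Q *ᵥ D.μ₀) := by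
    rw [Matrix.dotProduct_mulVec, ← Matrix.mulVec_transpose, hQ, dotProduct_comm]
  have htrace : (D.coeffQ w * z.Q).trace =
      w.τ * ((D.γ₂ • D.Sig₀ + Matrix.vecMulVec D.μ₀ D.μ₀)ᵀ * z.Q).trace -
      ∑ s, w.γ s * (D.ξ s ⬝ᵥ (z.Q *ᵥ D.ξ s)) + 2 * (D.meanShift w ⬝ᵥ (z.Q *ᵥ D.μ₀)) := by
    rw [Matrix.transpose_add, Matrix.transpose_smul, hSt, Matrix.transpose_vecMulVec]
    simp only [coeffQ, add_mul, sub_mul, Finset.sum_mul, Matrix.trace_add, Matrix.trace_sub,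
      Matrix.trace_sum, Matrix.smul_mul, Matrix.trace_smul, smul_eq_mul, trace_vecMulVec_mul,
      hsymm]
    ring
  rw [lagrangian, hscen, heq, hfol, hcone, htrace, objective, coneScalar]
  simp only [dotProduct_sub, dotProduct_add, dotProduct_smul, Finset.sum_sub_distrib,
    Finset.sum_add_distrib, smul_eq_mul, dotProduct_comm z.q D.μ₀]
  ring

/-- The slope of an affine function that is bounded below on the half-line `0 ≤ a`. -/
theorem coeff_nonneg_of_bddBelow {M C l : ℝ} (h : ∀ a : ℝ, 0 ≤ a → M ≤ C + a * l) : 0 ≤ l := by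
  by_contra! hl
  have hM : M ≤ C := by simpa using h 0 le_rfl
  have := h ((C - M + 1) / -l) (div_nonneg (by linarith) (by linarith))
  rw [div_mul_eq_mul_div, div_neg, mul_div_cancel_right₀ _ hl.ne] at this
  linarith

theorem coeff_eq_zero_of_bddBelow {M C l : ℝ} (h : ∀ a : ℝ, M ≤ C + a * l) : l = 0 :=
  le_antisymm
    (neg_nonneg.mp <| coeff_nonneg_of_bddBelow (M := M) (C := C) fun a _ => by simpa using h (-a))
    (coeff_nonneg_of_bddBelow fun a _ => h a)

theorem sum_single_dotProduct {N l : ℕ} (s : Fin N) (i : Fin l) (a : ℝ) (f : Fin N → Fin l → ℝ) :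
    ∑ s', (Pi.single s (Pi.single i a) : Fin N → Fin l → ℝ) s' ⬝ᵥ f s' = a * f s i := by
  rw [Finset.sum_eq_single s (fun s' _ hs' => by simp [hs']) (by simp), Pi.single_eq_same,
    single_dotProduct]

theorem isHermitian_coeffQ (hS : D.Sig₀.PosDef) (w : Multipliers k n m N) :
    (D.coeffQ w).IsHermitian := by
  have hSt : D.Sig₀ᵀ = D.Sig₀ := by
    rw [← Matrix.conjTranspose_eq_transpose_of_trivial]
    exact hS.isHermitian
  rw [Matrix.IsHermitian, Matrix.conjTranspose_eq_transpose_of_trivial]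
  simp only [coeffQ, Matrix.transpose_add, Matrix.transpose_sub, Matrix.transpose_smul,
    Matrix.transpose_sum, Matrix.transpose_vecMulVec, hSt]
  rw [add_comm (Matrix.vecMulVec D.μ₀ (D.meanShift w))]

/-- A dual feasible multiplier satisfies the explicit constraints: an affine function is bounded
below on a cone only if its linear part is nonnegative there. -/
theorem DualFeasible.dualConstraints {D : Instance d k n m N} {x : Fin d → ℝ}
    {w : Multipliers k n m N} (hS : D.Sig₀.PosDef) (hw : D.DualFeasible x w) :
    D.DualConstraints x w := by
  obtain ⟨M, hM⟩ : ∃ M : ℝ, ∀ z ∈ signConstraints k n m N, M ≤ D.lagrangian x z w := by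
    have hle : ∀ z ∈ signConstraints k n m N, D.dualObjective x w ≤ (D.lagrangian x z w : EReal) :=
      fun z hz => iInf₂_le z hz
    refine ⟨(D.dualObjective x w).toReal, fun z hz => ?_⟩
    have := hle z hz
    rw [← EReal.coe_toReal (ne_top_of_le_ne_top (EReal.coe_ne_top _) this) hw.2] at this
    exact_mod_cast this
  set C := ∑ s, w.χ s ⬝ᵥ D.v s with hC
  have key : ∀ (Q : Matrix (Fin k) (Fin k) ℝ) (q : Fin k → ℝ) (r t lam : ℝ)
      (p : Fin N → Fin m → ℝ) (y : Fin N → Fin n → ℝ), Q.PosSemidef → 0 ≤ lam → (∀ s, 0 ≤ p s) →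
      M ≤ C + r * (1 - ∑ s, w.γ s) + t * (1 - w.τ) -
        lam * ∑ s, (w.χ s ⬝ᵥ D.c s + w.σ s ⬝ᵥ D.rhs x s) +
        ∑ s, p s ⬝ᵥ (w.γ s • D.rhs x s - D.A *ᵥ w.χ s) +
        ∑ s, y s ⬝ᵥ (w.γ s • D.c s + D.Aᵀ *ᵥ w.σ s) +
        q ⬝ᵥ (w.τ • D.μ₀ + D.meanShift w - ∑ s, w.γ s • D.ξ s) + (D.coeffQ w * Q).trace := by
    intro Q q r t lam p y hQ hlam hp
    have := hM ⟨Q, q, r, t, lam, p, y⟩ ⟨hQ, hlam, hp⟩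
    rwa [D.lagrangian_eq hS x _ w (by
      rw [← Matrix.conjTranspose_eq_transpose_of_trivial]; exact hQ.isHermitian)] at this
  have hr : 1 - ∑ s, w.γ s = 0 := coeff_eq_zero_of_bddBelow (M := M) (C := C) fun a => by
    simpa using key 0 0 a 0 0 0 0 .zero le_rfl fun _ => le_rfl
  have ht : 1 - w.τ = 0 := coeff_eq_zero_of_bddBelow (M := M) (C := C) fun a => by
    simpa using key 0 0 0 a 0 0 0 .zero le_rfl fun _ => le_rfl
  have hτ : w.τ = 1 := by linarith
  have hlam : 0 ≤ -∑ s, (w.χ s ⬝ᵥ D.c s + w.σ s ⬝ᵥ D.rhs x s) :=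
    coeff_nonneg_of_bddBelow (M := M) (C := C) fun a ha => by
      simpa [sub_eq_add_neg] using key 0 0 0 0 a 0 0 .zero ha fun _ => le_rfl
  have hp : ∀ s, D.A *ᵥ w.χ s ≤ w.γ s • D.rhs x s := fun s i => by
    refine sub_nonneg.mp ?_
    refine coeff_nonneg_of_bddBelow (M := M) (C := C) fun a ha => ?_
    have := key 0 0 0 0 0 (Pi.single s (Pi.single i a)) 0 .zero le_rfl fun s' => by
      by_cases h : s' = s
      · subst h; simpa using ha
      · simp [h]
    rw [sum_single_dotProduct] at this
    simpa using this
  have hy : ∀ s, w.γ s • D.c s + D.Aᵀ *ᵥ w.σ s = 0 := fun s => by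
    funext i
    refine coeff_eq_zero_of_bddBelow (M := M) (C := C) fun a => ?_
    have := key 0 0 0 0 0 0 (Pi.single s (Pi.single i a)) .zero le_rfl fun _ => le_rfl
    rw [sum_single_dotProduct] at this
    simpa using this
  have hq : w.τ • D.μ₀ + D.meanShift w - ∑ s, w.γ s • D.ξ s = 0 := by
    funext i
    refine coeff_eq_zero_of_bddBelow (M := M) (C := C) fun a => ?_
    have := key 0 (Pi.single i a) 0 0 0 0 0 .zero le_rfl fun _ => le_rfl
    rw [single_dotProduct] at this
    simpa using this
  refine ⟨by linarith, hτ, by linarith, hp, hy, ?_, ?_⟩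
  · rw [hτ, one_smul] at hq
    exact sub_eq_zero.mp hq
  · refine .of_dotProduct_mulVec_nonneg (D.isHermitian_coeffQ hS w) fun u => ?_
    refine coeff_nonneg_of_bddBelow (M := M) (C := C) fun a ha => ?_
    have hu : (a • Matrix.vecMulVec u u).PosSemidef := by
      simpa using (Matrix.posSemidef_vecMulVec_self_star u).smul ha
    have := key _ 0 0 0 0 0 0 hu le_rfl fun _ => le_rfl
    rw [Matrix.trace_mul_comm, Matrix.smul_mul, Matrix.trace_smul, trace_vecMulVec_mul] at this
    simpa using this

/-- Under the explicit constraints the infimum of the Lagrangian is its value at `0`. -/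
theorem DualConstraints.dualObjective_eq {D : Instance d k n m N} {x : Fin d → ℝ}
    {w : Multipliers k n m N} (hS : D.Sig₀.PosDef) (hw : D.DualConstraints x w) :
    D.dualObjective x w = ((∑ s, w.χ s ⬝ᵥ D.v s : ℝ) : EReal) := by
  refine le_antisymm ?_ (le_iInf₂ fun z hz => ?_)
  · refine (iInf₂_le (⟨0, 0, 0, 0, 0, 0, 0⟩ : PrimalVars k n m N)
      ⟨.zero, le_rfl, fun _ => le_rfl⟩).trans_eq ?_
    rw [D.lagrangian_eq hS x _ w (by simp)]
    simp
  · obtain ⟨hQ, hlam, hp⟩ := hz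
    rw [D.lagrangian_eq hS x z w (by
      rw [← Matrix.conjTranspose_eq_transpose_of_trivial]; exact hQ.isHermitian)]
    simp only [hw.sum_γ, hw.τ_eq, hw.stationary_y, one_smul, hw.mean, sub_self, mul_zero,
      dotProduct_zero, Finset.sum_const_zero, add_zero]
    have h₁ : 0 ≤ ∑ s, z.p s ⬝ᵥ (w.γ s • D.rhs x s - D.A *ᵥ w.χ s) :=
      Finset.sum_nonneg fun s _ =>
        dotProduct_nonneg_of_nonneg (hp s) (sub_nonneg.mpr (hw.mulVec_χ_le s))
    have h₂ := mul_nonpos_of_nonneg_of_nonpos hlam hw.gap_nonpos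
    have h₃ := trace_mul_nonneg_of_posSemidef hw.posSemidef_coeffQ hQ
    exact_mod_cast (by linarith)

/-- Each `χ s` is `γ s` times an optimal response of the follower, so the dual objective is at most
the expected pessimistic cost under `γ`. -/
theorem DualConstraints.dotProduct_v_le {D : Instance d k n m N} {x : Fin d → ℝ}
    {w : Multipliers k n m N} (hrec : D.HasRecourse x) (hcone : w ∈ dualCone k n m N)
    (hw : D.DualConstraints x w) : ∑ s, w.χ s ⬝ᵥ D.v s ≤ D.expectedCost x w.γ := by
  have hgap : ∀ s, 0 ≤ w.χ s ⬝ᵥ D.c s + w.σ s ⬝ᵥ D.rhs x s := fun s =>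
    D.dualityGap_nonneg hrec s (hcone.1 s) (hcone.2.1 s) (hw.mulVec_χ_le s) (hw.stationary_y s)
  -- The gaps are nonnegative with a nonpositive sum, so each of them vanishes.
  have hzero := (Finset.sum_eq_zero_iff_of_nonneg fun s _ => hgap s).mp
    (le_antisymm hw.gap_nonpos (Finset.sum_nonneg fun s _ => hgap s))
  exact Finset.sum_le_sum fun s hs =>
    D.dotProduct_v_le_of_dualityGap_eq_zero hrec s (hcone.1 s) (hcone.2.1 s) (hw.mulVec_χ_le s)
      (hw.stationary_y s) (hzero s hs)

/-! ### Multipliers and the ambiguity set -/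

/-- Passing from second moments about `0` to second moments about `μ₀`. -/
theorem coeffQ_eq {w : Multipliers k n m N} (hsum : ∑ s, w.γ s = 1) (hτ : w.τ = 1)
    (hmean : D.μ₀ + D.meanShift w = ∑ s, w.γ s • D.ξ s) :
    D.coeffQ w = D.γ₂ • D.Sig₀ -
      ∑ s, w.γ s • Matrix.vecMulVec (D.ξ s - D.μ₀) (D.ξ s - D.μ₀) := by
  have hshift : ∀ i, D.meanShift w i = ∑ s, w.γ s * D.ξ s i - D.μ₀ i := fun i => by
    have := congrFun hmean i
    simp only [Pi.add_apply, Finset.sum_apply, Pi.smul_apply, smul_eq_mul] at this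
    linarith
  ext i j
  have hexp : ∑ s, w.γ s * ((D.ξ s i - D.μ₀ i) * (D.ξ s j - D.μ₀ j)) =
      ∑ s, w.γ s * (D.ξ s i * D.ξ s j) - (∑ s, w.γ s * D.ξ s i) * D.μ₀ j -
        D.μ₀ i * (∑ s, w.γ s * D.ξ s j) + (∑ s, w.γ s) * (D.μ₀ i * D.μ₀ j) := by
    simp only [Finset.sum_mul, Finset.mul_sum, ← Finset.sum_sub_distrib, ← Finset.sum_add_distrib]
    exact Finset.sum_congr rfl fun s _ => by ring
  simp only [coeffQ, hτ, one_smul, Matrix.add_apply, Matrix.sub_apply, Matrix.smul_apply,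
    Matrix.sum_apply, Matrix.vecMulVec_apply, smul_eq_mul, Pi.sub_apply, hshift, hexp, hsum]
  ring

/-- The constraint `‖μ‖ ≤ τ = 1` bounds the mean, and `Q ⪰ 0` dualizes to the second moment
bound. -/
theorem DualConstraints.mem_ambiguitySet {D : Instance d k n m N} {x : Fin d → ℝ}
    {w : Multipliers k n m N} (hS : D.Sig₀.PosDef) (hγ₁ : 0 ≤ D.γ₁)
    (hcone : w ∈ dualCone k n m N) (hw : D.DualConstraints x w) : w.γ ∈ D.ambiguitySet := by
  refine ⟨hcone.1, hw.sum_γ, ?_, D.coeffQ_eq hw.sum_γ hw.τ_eq hw.mean ▸ hw.posSemidef_coeffQ⟩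
  have hμ : w.μ ⬝ᵥ w.μ ≤ 1 := by
    have h₁ : l2norm w.μ ≤ 1 := hw.τ_eq ▸ hcone.2.2
    rw [← l2norm_sq]
    exact pow_le_one₀ (norm_nonneg _) h₁
  rw [← hw.mean, add_sub_cancel_left, meanShift, Matrix.mulVec_smul, smul_dotProduct,
    dotProduct_smul, D.sqrtSig₀_mulVec_dotProduct_inv hS, smul_eq_mul, smul_eq_mul, ← mul_assoc,
    Real.mul_self_sqrt hγ₁]
  exact mul_le_of_le_one_right hγ₁ hμ

/-- Every deviation `u` of the mean admitted by the ambiguity set comes from a multiplier in the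
unit ball. -/
theorem exists_meanShift_eq (hS : D.Sig₀.PosDef) (hγ₁ : 0 ≤ D.γ₁) {u : Fin k → ℝ}
    (hu : u ⬝ᵥ (D.Sig₀⁻¹ *ᵥ u) ≤ D.γ₁) :
    ∃ e : Fin k → ℝ, l2norm e ≤ 1 ∧ √D.γ₁ • (D.sqrtSig₀ *ᵥ e) = u := by
  set f := D.sqrtSig₀⁻¹ *ᵥ u with hf
  have hfu : D.sqrtSig₀ *ᵥ f = u := by
    rw [hf, Matrix.mulVec_mulVec, Matrix.mul_nonsing_inv _ (D.isUnit_det_sqrtSig₀ hS),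
      Matrix.one_mulVec]
  rw [← hfu, D.sqrtSig₀_mulVec_dotProduct_inv hS] at hu
  rcases hγ₁.eq_or_lt with h₀ | hpos
  · have hf₀ : f = 0 := dotProduct_self_eq_zero.mp <| le_antisymm (h₀ ▸ hu) <| by
      rw [← l2norm_sq]; positivity
    exact ⟨0, by simp [l2norm], by rw [← hfu, hf₀]; simp⟩
  · have hsq : 0 < √D.γ₁ := Real.sqrt_pos.mpr hpos
    refine ⟨(√D.γ₁)⁻¹ • f, ?_, ?_⟩
    · rw [l2norm, WithLp.toLp_smul, norm_smul, norm_inv, Real.norm_of_nonneg hsq.le,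
        inv_mul_le_iff₀ hsq, mul_one]
      exact Real.le_sqrt_of_sq_le ((l2norm_sq f).trans_le hu)
    · rw [Matrix.mulVec_smul, smul_smul, mul_inv_cancel₀ hsq.ne', one_smul, hfu]

/-- Every distribution in the ambiguity set is the scenario part of a dual feasible multiplier
whose objective value is the expected pessimistic cost. -/
theorem exists_dualFeasible_of_mem_ambiguitySet {x : Fin d → ℝ} (hS : D.Sig₀.PosDef)
    (hγ₁ : 0 ≤ D.γ₁) (hrec : D.HasRecourse x) {p : Fin N → ℝ} (hp : p ∈ D.ambiguitySet) :
    ∃ w, D.DualFeasible x w ∧ D.dualObjective x w = (D.expectedCost x p : EReal) := by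
  obtain ⟨hp₀, hsum, hmean, hcov⟩ := hp
  obtain ⟨e, he, heu⟩ := D.exists_meanShift_eq hS hγ₁ hmean
  choose y hy hyv using fun s => (D.isGreatest_pessimisticCost hrec s).1
  choose a ha₀ hac hagap using fun s =>
    exists_dual_certificate D.A (D.rhs x s) (D.c s) (y s) (hy s).1 (hy s).2
  let w : Multipliers k n m N := ⟨p, fun s => p s • y s, fun s => p s • a s, 1, e⟩
  have hw : D.DualConstraints x w := by
    have hmean' : D.μ₀ + D.meanShift w = ∑ s, w.γ s • D.ξ s := by
      change D.μ₀ + √D.γ₁ • (D.sqrtSig₀ *ᵥ e) = ∑ s, p s • D.ξ s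
      rw [heu, add_sub_cancel]
    refine ⟨hsum, rfl, Finset.sum_nonpos fun s _ => ?_, fun s => ?_, fun s => ?_, hmean', ?_⟩
    · simp only [w, smul_dotProduct, ← smul_add]
      exact mul_nonpos_of_nonneg_of_nonpos (hp₀ s) (hagap s)
    · simp only [w, Matrix.mulVec_smul]
      exact smul_le_smul_of_nonneg_left (hy s).1 (hp₀ s)
    · simp only [w, Matrix.mulVec_smul, ← smul_add, hac, smul_zero]
    · rw [D.coeffQ_eq hsum rfl hmean']
      exact hcov
  have hval : D.dualObjective x w = (D.expectedCost x p : EReal) := by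
    rw [hw.dualObjective_eq hS, expectedCost]
    congr 1
    refine Finset.sum_congr rfl fun s _ => ?_
    rw [← hyv, smul_dotProduct, smul_eq_mul, dotProduct_comm]
  refine ⟨w, ⟨⟨hp₀, fun s => smul_nonneg (hp₀ s) (ha₀ s), he⟩, ?_⟩, hval⟩
  rw [hval]
  exact EReal.coe_ne_bot _

end PessimisticBilevel.Instance

theorem theorem5 {d k n m N : ℕ} (D : PessimisticBilevel.Instance d k n m N) (x : Fin d → ℝ)
    (hSigma : D.Sig₀.PosDef) (hγ₁ : 0 ≤ D.γ₁) (hγ₂ : 1 ≤ D.γ₂) (hrec : D.HasRecourse x)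
    (w : PessimisticBilevel.Multipliers k n m N) (hw : D.DualOptimal x w) :
    w.γ ∈ D.ambiguitySet ∧
      (∀ s, IsGreatest (D.leaderCosts x s) (D.pessimisticCost x s)) ∧
      IsGreatest (D.expectedCost x '' D.ambiguitySet) (D.expectedCost x w.γ) := by
  have hcon := hw.1.dualConstraints hSigma
  have hmem := hcon.mem_ambiguitySet hSigma hγ₁ hw.1.1
  refine ⟨hmem, D.isGreatest_pessimisticCost hrec, ⟨w.γ, hmem, rfl⟩, ?_⟩
  rintro _ ⟨p, hp, rfl⟩
  obtain ⟨w', hw', hval⟩ := D.exists_dualFeasible_of_mem_ambiguitySet hSigma hγ₁ hrec hp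
  have hle := hw.2 w' hw'
  rw [hval, hcon.dualObjective_eq hSigma, EReal.coe_le_coe_iff] at hle
  exact hle.trans (hcon.dotProduct_v_le hrec hw.1.1)
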